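/- Let $X$ be an alphabet with $|X|=2$. For a nonempty finite word $u$ over $X$ let $u^\infty=\dots uuu\dots$ be the two-sided infinite word with period $u$; call $u$ periodic if $u=v^k$ for some word $v$ and some $k\ge 2$, and non-periodic otherwise. For a two-sided infinite word $W$ let $C(W)$ be the set of all finite words $v$ such that $v$ is not a subword (contiguous factor) of $W$ but every proper subword of $v$ is a subword of $W$. A finite word satisfies $C(W)$ if none of its subwords belongs to $C(W)$. A finite word $v$ (possibly empty) is called a finite fork of $W$ if $v$ satisfies $C(W)$, there are two distinct letters $x\ne y$ such that $vx$ and $vy$ satisfy $C(W)$, and there are two distinct letters $x'\ne y'$ such that $x'v$ and $y'v$ satisfy $C(W)$. Let $F(0)=F(1)=1$ and $F(k+1)=F(k)+F(k-1)$ for $k\ge 1$. Theorem. Let $u$ be a nonempty non-periodic finite word over $X$, let $W=u^\infty$, and suppose that $W$ has exactly $n$ finite forks. Then $|u|\le F(n+1)$. -/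

import Mathlib

namespace ForbiddenWords

/-- Finite words over `X` are lists; `w <:+: v` (`List.IsInfix`) says that `w` is a subword of `v`.
A word is periodic if it is nonempty and equals `v ^ n` for some word `v` and some `n ≥ 2`. -/
def IsPeriodicWord {X : Type*} (u : List X) : Prop :=
  u ≠ [] ∧ ∃ (v : List X) (n : ℕ), 2 ≤ n ∧ u = (List.replicate n v).flatten

/-- The two-sided infinite word `u^∞ = … u u u …`, one copy of `u` starting at position `0`. -/
def infinitePower {X : Type*} (u : List X) (hu : u ≠ []) : ℤ → X := fun i =>
  u[(i % (u.length : ℤ)).toNat]'(by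
    have hpos : 0 < u.length := List.length_pos_iff.mpr hu
    have h1 := Int.emod_nonneg i (b := (u.length : ℤ)) (by omega)
    have h2 := Int.emod_lt_of_pos i (b := (u.length : ℤ)) (by omega)
    omega)

/-- The finite word `v` is a subword of the two-sided infinite word `W`. -/
def IsSubwordOf {X : Type*} (v : List X) (W : ℤ → X) : Prop :=
  ∃ i : ℤ, ∀ (k : ℕ) (hk : k < v.length), v[k] = W (i + k)

/-- The finite word `w` satisfies the system of forbidden words `V`. -/
def Satisfies {X : Type*} (w : List X) (V : Set (List X)) : Prop :=
  ∀ v ∈ V, ¬ v <:+: w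

/-- The canonical system of forbidden words `C(W)`: the words that are not subwords of `W` while
all their proper subwords are. -/
def canonicalSystem {X : Type*} (W : ℤ → X) : Set (List X) :=
  {v | ¬ IsSubwordOf v W ∧ ∀ w : List X, w <:+: v → w ≠ v → IsSubwordOf w W}

/-- `u` is a fork relative to `V`: it satisfies `V`, and it has at least two continuations to the
right and at least two continuations to the left that satisfy `V`. -/
def IsForkRel {X : Type*} (u : List X) (V : Set (List X)) : Prop :=
  Satisfies u V ∧
    (∃ x y : X, x ≠ y ∧ Satisfies (u ++ [x]) V ∧ Satisfies (u ++ [y]) V) ∧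
    (∃ x y : X, x ≠ y ∧ Satisfies (x :: u) V ∧ Satisfies (y :: u) V)

/-- The set of all finite forks of a two-sided infinite word `W`. -/
def finiteForks {X : Type*} (W : ℤ → X) : Set (List X) :=
  {v | IsForkRel v (canonicalSystem W)}

/-- The Fibonacci numbers with `F 0 = F 1 = 1` and `F (k + 2) = F (k + 1) + F k`. -/
def F : ℕ → ℕ
  | 0 => 1
  | 1 => 1
  | k + 2 => F (k + 1) + F k

end ForbiddenWords

/-! Forks of `W` are its bispecial factors. Over two letters, a word of least period `N` has exactly
`N - 1` right special factors, namely the suffixes of its forks, so the forks determine `N`.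

Induct on `N > 1`. A longest factor `v` found at two positions incongruent mod `N` is a fork and has
exactly two occurrences mod `N` (`exists_occursTwice`). Cutting the cycle there gives two loops of
lengths `M` and `N - M`, whose forks are forks of `W` other than `v` (`finiteForks_loop_subset`). If
`W` has `n` forks, each loop has at most `n - 1`. If one has at most `n - 2`, then `N ≤ F n + F (n -
1)`. If both have `n - 1`, a count of right special factors forces `n = 1`
(`finiteForks_eq_singleton`), whence `N ≤ 2`. -/

namespace ForbiddenWords

/-! ### Factors as windows -/

variable {X : Type*}

/-- The factor of `W` of length `m` starting at position `i`. -/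
def window (W : ℤ → X) (i : ℤ) (m : ℕ) : List X := List.ofFn fun t : Fin m => W (i + (t : ℕ))

@[simp] theorem length_window (W : ℤ → X) (i : ℤ) (m : ℕ) : (window W i m).length = m := by
  simp [window]

@[simp] theorem getElem_window (W : ℤ → X) (i : ℤ) (m k : ℕ) (h : k < (window W i m).length) :
    (window W i m)[k] = W (i + k) := by
  simp [window]

theorem window_eq_iff {W V : ℤ → X} {i j : ℤ} {m : ℕ} :
    window W i m = window V j m ↔ ∀ t : ℕ, t < m → W (i + t) = V (j + t) := by
  constructor
  · intro h t ht
    have h1 : (window W i m)[t]'(by simpa) = (window V j m)[t]'(by simpa) := by simp only [h]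
    simpa using h1
  · intro h
    apply List.ext_getElem (by simp)
    intro k h1 h2
    simpa using h k (by simpa using h1)

theorem isSubwordOf_iff {v : List X} {W : ℤ → X} :
    IsSubwordOf v W ↔ ∃ i, v = window W i v.length := by
  constructor
  · rintro ⟨i, hi⟩
    refine ⟨i, List.ext_getElem (by simp) ?_⟩
    intro k h1 h2
    simpa using hi k h1
  · rintro ⟨i, hi⟩
    refine ⟨i, fun k hk => ?_⟩
    have h1 : v[k] = (window W i v.length)[k]'(by simpa) := by simp only [← hi]
    simpa using h1

theorem isSubwordOf_window (W : ℤ → X) (i : ℤ) (m : ℕ) : IsSubwordOf (window W i m) W :=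
  isSubwordOf_iff.2 ⟨i, by simp⟩

theorem window_add (W : ℤ → X) (i : ℤ) (m l : ℕ) :
    window W i (m + l) = window W i m ++ window W (i + m) l := by
  apply List.ext_getElem (by simp)
  intro k h1 h2
  rw [List.getElem_append]
  split_ifs with h
  · simp
  · simp only [length_window, not_lt] at h
    simp only [getElem_window, length_window]
    congr 1
    push_cast [h]
    ring

theorem window_one (W : ℤ → X) (i : ℤ) : window W i 1 = [W i] := by simp [window]

theorem window_succ (W : ℤ → X) (i : ℤ) (m : ℕ) :
    window W i (m + 1) = window W i m ++ [W (i + m)] := by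
  rw [window_add, window_one]

theorem window_pred (W : ℤ → X) (i : ℤ) (m : ℕ) :
    window W (i - 1) (m + 1) = W (i - 1) :: window W i m := by
  rw [add_comm m 1, window_add, window_one]
  simp

theorem IsSubwordOf.of_infix {W : ℤ → X} {v w : List X} (h : v <:+: w) (hw : IsSubwordOf w W) :
    IsSubwordOf v W := by
  obtain ⟨s, t, rfl⟩ := h
  obtain ⟨i, hi⟩ := hw
  refine ⟨i + s.length, fun k hk => ?_⟩
  have h1 := hi (s.length + k) (by simp; omega)
  rw [List.getElem_append_left (by simp; omega), List.getElem_append_right (by omega)] at h1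
  simp only [add_tsub_cancel_left] at h1
  rw [h1]
  push_cast
  rw [add_assoc]

theorem isSubwordOf_append_singleton {W : ℤ → X} {w : List X} {x : X} :
    IsSubwordOf (w ++ [x]) W ↔ ∃ i, w = window W i w.length ∧ x = W (i + w.length) := by
  rw [isSubwordOf_iff]
  refine exists_congr fun i => ?_
  rw [List.length_append, List.length_singleton, window_succ]
  constructor
  · intro h
    have := List.append_inj h (by simp)
    simpa using this
  · rintro ⟨h1, h2⟩
    rw [← h1, ← h2]

theorem isSubwordOf_cons {W : ℤ → X} {w : List X} {x : X} :
    IsSubwordOf (x :: w) W ↔ ∃ i, w = window W i w.length ∧ x = W (i - 1) := by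
  rw [isSubwordOf_iff]
  constructor
  · rintro ⟨i, hi⟩
    have h := window_pred W (i + 1) w.length
    rw [add_sub_cancel_right] at h
    rw [List.length_cons, h, List.cons.injEq] at hi
    exact ⟨i + 1, hi.2, by simpa using hi.1⟩
  · rintro ⟨i, h1, h2⟩
    refine ⟨i - 1, ?_⟩
    rw [List.length_cons, window_pred, ← h1, ← h2]

/-- A finite word satisfies the canonical system of `W` exactly when it is a factor of `W`. -/
theorem satisfies_canonicalSystem_iff {W : ℤ → X} {w : List X} :
    Satisfies w (canonicalSystem W) ↔ IsSubwordOf w W := by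
  constructor
  · intro h
    by_contra hw
    -- A shortest subword of `w` that is not a factor would lie in the canonical system.
    have key : ∀ n : ℕ, ∀ v : List X, v.length = n → v <:+: w → IsSubwordOf v W := by
      intro n
      induction n using Nat.strong_induction_on with
      | _ n ih =>
        intro v hv hvw
        by_contra hnot
        refine h v ⟨hnot, fun z hz hne => ?_⟩ hvw
        refine ih z.length ?_ z rfl (hz.trans hvw)
        have h1 := hz.length_le
        have h2 : z.length ≠ v.length := fun h => hne (hz.eq_of_length h)
        omega
    exact hw (key _ w rfl List.infix_rfl)
  · intro h v hv hvw
    exact hv.1 (h.of_infix hvw)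

/-! ### Special factors and forks -/

/-- The right special factors of `W`. -/
def rightSpecial (W : ℤ → X) : Set (List X) :=
  {w | ∃ x y : X, x ≠ y ∧ IsSubwordOf (w ++ [x]) W ∧ IsSubwordOf (w ++ [y]) W}

/-- The left special factors of `W`. -/
def leftSpecial (W : ℤ → X) : Set (List X) :=
  {w | ∃ x y : X, x ≠ y ∧ IsSubwordOf (x :: w) W ∧ IsSubwordOf (y :: w) W}

theorem finiteForks_eq (W : ℤ → X) : finiteForks W = rightSpecial W ∩ leftSpecial W := by
  ext w
  simp only [finiteForks, IsForkRel, satisfies_canonicalSystem_iff, Set.mem_ofPred_eq,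
    Set.mem_inter_iff, rightSpecial, leftSpecial]
  refine and_iff_right_of_imp ?_
  rintro ⟨⟨x, y, -, h, -⟩, -⟩
  exact h.of_infix (List.prefix_append _ _).isInfix

theorem mem_rightSpecial_iff {W : ℤ → X} {w : List X} :
    w ∈ rightSpecial W ↔ ∃ i j, w = window W i w.length ∧ w = window W j w.length ∧
      W (i + w.length) ≠ W (j + w.length) := by
  simp only [rightSpecial, Set.mem_ofPred_eq, isSubwordOf_append_singleton]
  constructor
  · rintro ⟨x, y, hxy, ⟨i, hi, rfl⟩, ⟨j, hj, rfl⟩⟩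
    exact ⟨i, j, hi, hj, hxy⟩
  · rintro ⟨i, j, hi, hj, hij⟩
    exact ⟨_, _, hij, ⟨i, hi, rfl⟩, ⟨j, hj, rfl⟩⟩

theorem mem_leftSpecial_iff {W : ℤ → X} {w : List X} :
    w ∈ leftSpecial W ↔ ∃ i j, w = window W i w.length ∧ w = window W j w.length ∧
      W (i - 1) ≠ W (j - 1) := by
  simp only [leftSpecial, Set.mem_ofPred_eq, isSubwordOf_cons]
  constructor
  · rintro ⟨x, y, hxy, ⟨i, hi, rfl⟩, ⟨j, hj, rfl⟩⟩
    exact ⟨i, j, hi, hj, hxy⟩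
  · rintro ⟨i, j, hi, hj, hij⟩
    exact ⟨_, _, hij, ⟨i, hi, rfl⟩, ⟨j, hj, rfl⟩⟩

theorem rightSpecial_of_suffix {W : ℤ → X} {v w : List X} (h : v <:+ w)
    (hw : w ∈ rightSpecial W) : v ∈ rightSpecial W := by
  obtain ⟨s, rfl⟩ := h
  obtain ⟨x, y, hxy, hx, hy⟩ := hw
  refine ⟨x, y, hxy, hx.of_infix ?_, hy.of_infix ?_⟩ <;>
    exact (List.append_assoc s v _ ▸ List.suffix_append s _).isInfix

/-! ### Least periods and counting of factors -/

/-- `W` is periodic with least period `N`. -/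
structure IsLeastPeriod (W : ℤ → X) (N : ℕ) : Prop where
  pos : 0 < N
  period : ∀ i, W (i + N) = W i
  dvd : ∀ q : ℤ, (∀ i, W (i + q) = W i) → (N : ℤ) ∣ q

theorem period_mul {W : ℤ → X} {q : ℤ} (h : ∀ i, W (i + q) = W i) (i c : ℤ) :
    W (i + q * c) = W i := by
  induction c using Int.induction_on with
  | zero => simp
  | succ n ih => rw [← ih, ← h (i + q * n)]; congr 1; ring
  | pred n ih => rw [← ih, ← h (i + q * (-n - 1))]; congr 1; ring

theorem period_congr {W : ℤ → X} {q : ℤ} (h : ∀ i, W (i + q) = W i) {i j : ℤ} (hij : q ∣ j - i) :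
    W j = W i := by
  obtain ⟨c, hc⟩ := hij
  rw [← period_mul h i c, ← hc]
  congr 1
  ring

theorem isLeastPeriod_of_forall_not {W : ℤ → X} {N : ℕ} (hN : 0 < N)
    (hp : ∀ i, W (i + N) = W i)
    (hmin : ∀ q : ℤ, 0 < q → q < N → ¬ ∀ i, W (i + q) = W i) : IsLeastPeriod W N := by
  refine ⟨hN, hp, fun q hq => ?_⟩
  by_contra hd
  have hN' : (0 : ℤ) < N := by exact_mod_cast hN
  have h0 := Int.emod_nonneg q hN'.ne'
  have h1 := Int.emod_lt_of_pos q hN'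
  have h2 : q % N ≠ 0 := fun h => hd (Int.dvd_of_emod_eq_zero h)
  refine hmin (q % N) (by omega) h1 fun i => ?_
  rw [← hq i]
  refine period_congr hp ⟨-(q / N), ?_⟩
  rw [Int.emod_def]
  ring

namespace IsLeastPeriod

variable {W : ℤ → X} {N : ℕ}

theorem window_congr (h : IsLeastPeriod W N) {i j : ℤ} (hij : (N : ℤ) ∣ j - i) (m : ℕ) :
    window W i m = window W j m :=
  window_eq_iff.2 fun t _ => (period_congr h.period (by simpa using hij)).symm

/-- A window of length at least `N` meets every residue mod `N`, so the agreement makes `j - i` a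
period of `W`. -/
theorem dvd_of_window_eq (h : IsLeastPeriod W N) {i j : ℤ} {m : ℕ} (hm : N ≤ m)
    (hw : window W i m = window W j m) : (N : ℤ) ∣ j - i := by
  rw [window_eq_iff] at hw
  refine h.dvd _ fun s => ?_
  have hN' : (0 : ℤ) < N := by exact_mod_cast h.pos
  have h0 := Int.emod_nonneg (s - i) hN'.ne'
  have h1 := Int.emod_lt_of_pos (s - i) hN'
  have h2 := hw ((s - i) % N).toNat (by omega)
  rw [Int.toNat_of_nonneg h0] at h2
  have h3 : (s - i) % N = s - i - N * ((s - i) / N) := Int.emod_def _ _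
  rw [period_congr h.period (i := i + (s - i) % N) (j := s) ⟨(s - i) / N, by rw [h3]; ring⟩, h2]
  exact period_congr h.period ⟨(s - i) / N, by rw [h3]; ring⟩

theorem exists_window (h : IsLeastPeriod W N) {w : List X} (hw : IsSubwordOf w W) :
    ∃ i : ℕ, i < N ∧ w = window W i w.length := by
  obtain ⟨i, hi⟩ := isSubwordOf_iff.1 hw
  have hN' : (0 : ℤ) < N := by exact_mod_cast h.pos
  have h0 := Int.emod_nonneg i hN'.ne'
  have h1 := Int.emod_lt_of_pos i hN'
  refine ⟨(i % N).toNat, by omega, ?_⟩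
  rw [Int.toNat_of_nonneg h0]
  conv_lhs => rw [hi]
  refine h.window_congr ⟨-(i / N), ?_⟩ _
  rw [Int.emod_def]
  ring

theorem length_lt_of_mem_rightSpecial (h : IsLeastPeriod W N) {w : List X}
    (hw : w ∈ rightSpecial W) : w.length < N := by
  obtain ⟨i, j, hi, hj, hij⟩ := mem_rightSpecial_iff.1 hw
  by_contra! hlt
  have h1 := h.dvd_of_window_eq hlt (hi.symm.trans hj)
  exact hij (period_congr h.period (by simpa using h1)).symm

theorem finite_rightSpecial (h : IsLeastPeriod W N) : (rightSpecial W).Finite := by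
  refine (Set.Finite.image2 (fun i m : ℕ => window W i m) (Set.finite_Iio N)
    (Set.finite_Iio N)).subset fun w hw => ?_
  obtain ⟨x, -, -, hx, -⟩ := id hw
  obtain ⟨i, hi, hiw⟩ := h.exists_window (hx.of_infix (List.prefix_append _ _).isInfix)
  exact ⟨i, hi, w.length, h.length_lt_of_mem_rightSpecial hw, hiw.symm⟩

theorem finite_factors (h : IsLeastPeriod W N) (m : ℕ) :
    {w : List X | IsSubwordOf w W ∧ w.length = m}.Finite := by
  refine ((Set.finite_Iio N).image (fun i : ℕ => window W i m)).subset ?_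
  rintro w ⟨hw, rfl⟩
  obtain ⟨i, hi, hiw⟩ := h.exists_window hw
  exact ⟨i, hi, hiw.symm⟩

/-- Every factor has a chosen continuation `c`; exactly the right special ones have another, `o`,
and two letters leave room for no third. -/
theorem ncard_factors_succ (hX : ∀ x y z : X, x ≠ y → z = x ∨ z = y) (h : IsLeastPeriod W N)
    (m : ℕ) :
    {w : List X | IsSubwordOf w W ∧ w.length = m + 1}.ncard =
      {w : List X | IsSubwordOf w W ∧ w.length = m}.ncard +
        {w : List X | w ∈ rightSpecial W ∧ w.length = m}.ncard := by
  have hc : ∀ w : List X, ∃ x : X, IsSubwordOf w W → IsSubwordOf (w ++ [x]) W := by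
    intro w
    by_cases hw : IsSubwordOf w W
    · obtain ⟨i, hi⟩ := isSubwordOf_iff.1 hw
      exact ⟨_, fun _ => isSubwordOf_append_singleton.2 ⟨i, hi, rfl⟩⟩
    · exact ⟨W 0, fun h => absurd h hw⟩
  choose c hc using hc
  have ho : ∀ w : List X, ∃ x : X, w ∈ rightSpecial W → x ≠ c w ∧ IsSubwordOf (w ++ [x]) W := by
    intro w
    by_cases hw : w ∈ rightSpecial W
    · obtain ⟨x, y, hxy, hx, hy⟩ := hw
      by_cases hxc : x = c w
      · exact ⟨y, fun _ => ⟨fun h => hxy (hxc.trans h.symm), hy⟩⟩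
      · exact ⟨x, fun _ => ⟨hxc, hx⟩⟩
    · exact ⟨W 0, fun h => absurd h hw⟩
  choose o ho using ho
  have hinj : ∀ f : List X → X, Function.Injective fun w => w ++ [f w] := fun f a b hab =>
    (List.append_inj' hab rfl).1
  have hset : {w : List X | IsSubwordOf w W ∧ w.length = m + 1} =
      (fun w => w ++ [c w]) '' {w : List X | IsSubwordOf w W ∧ w.length = m} ∪
      (fun w => w ++ [o w]) '' {w : List X | w ∈ rightSpecial W ∧ w.length = m} := by
    ext z
    constructor
    · rintro ⟨hz, hzl⟩
      obtain ⟨w, x, rfl⟩ : ∃ w x, z = w ++ [x] := by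
        rcases List.eq_nil_or_concat z with rfl | ⟨w, x, h⟩
        · simp at hzl
        · exact ⟨w, x, by simpa using h⟩
      have hw : IsSubwordOf w W := hz.of_infix (List.prefix_append _ _).isInfix
      have hl : w.length = m := by simpa using hzl
      by_cases hx : x = c w
      · exact Or.inl ⟨w, ⟨hw, hl⟩, by simp [hx]⟩
      · have hR : w ∈ rightSpecial W := ⟨x, c w, hx, hz, hc w hw⟩
        refine Or.inr ⟨w, ⟨hR, hl⟩, ?_⟩
        rcases hX (c w) (o w) x (ho w hR).1.symm with h1 | h1
        · exact absurd h1 hx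
        · simp [h1]
    · rintro (⟨w, ⟨hw, hl⟩, rfl⟩ | ⟨w, ⟨hw, hl⟩, rfl⟩)
      · exact ⟨hc w hw, by simpa using hl⟩
      · exact ⟨(ho w hw).2, by simpa using hl⟩
  have hdisj : Disjoint
      ((fun w => w ++ [c w]) '' {w : List X | IsSubwordOf w W ∧ w.length = m})
      ((fun w => w ++ [o w]) '' {w : List X | w ∈ rightSpecial W ∧ w.length = m}) := by
    rw [Set.disjoint_left]
    rintro _ ⟨w, -, rfl⟩ ⟨z, ⟨hz, -⟩, hzw⟩
    obtain ⟨rfl, h2⟩ := List.append_inj' hzw rfl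
    exact (ho z hz).1 (by simpa using h2)
  rw [hset, Set.ncard_union_eq hdisj ((h.finite_factors m).image _)
      ((h.finite_rightSpecial.subset fun w hw => hw.1).image _),
    Set.ncard_image_of_injective _ (hinj c), Set.ncard_image_of_injective _ (hinj o)]

theorem ncard_factors (hX : ∀ x y z : X, x ≠ y → z = x ∨ z = y) (h : IsLeastPeriod W N) (m : ℕ) :
    {w : List X | IsSubwordOf w W ∧ w.length = m}.ncard =
      {w : List X | w ∈ rightSpecial W ∧ w.length < m}.ncard + 1 := by
  induction m with
  | zero =>
    have h1 : {w : List X | IsSubwordOf w W ∧ w.length = 0} = {[]} := by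
      ext w
      simp only [List.length_eq_zero_iff, Set.mem_ofPred_eq, Set.mem_singleton_iff,
        and_iff_right_iff_imp]
      rintro rfl
      exact ⟨0, by simp⟩
    rw [h1]
    simp
  | succ m ih =>
    have h1 : {w : List X | w ∈ rightSpecial W ∧ w.length < m + 1} =
        {w : List X | w ∈ rightSpecial W ∧ w.length < m} ∪
          {w : List X | w ∈ rightSpecial W ∧ w.length = m} := by
      ext w
      simp only [Set.mem_ofPred_eq, Set.mem_union, ← and_or_left]
      rw [Nat.lt_succ_iff_lt_or_eq]
    have hdisj : Disjoint {w : List X | w ∈ rightSpecial W ∧ w.length < m}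
        {w : List X | w ∈ rightSpecial W ∧ w.length = m} := by
      rw [Set.disjoint_left]
      rintro w ⟨-, h1⟩ ⟨-, h2⟩
      omega
    rw [h.ncard_factors_succ hX, ih, h1, Set.ncard_union_eq hdisj
      (h.finite_rightSpecial.subset fun w hw => hw.1)
      (h.finite_rightSpecial.subset fun w hw => hw.1)]
    ring

/-- A binary word of least period `N` has `N - 1` right special factors. -/
theorem ncard_rightSpecial (hX : ∀ x y z : X, x ≠ y → z = x ∨ z = y) (h : IsLeastPeriod W N) :
    (rightSpecial W).ncard + 1 = N := by
  have h1 := h.ncard_factors hX N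
  have h2 : {w : List X | w ∈ rightSpecial W ∧ w.length < N} = rightSpecial W := by
    ext w
    exact and_iff_left_of_imp h.length_lt_of_mem_rightSpecial
  have h3 : {w : List X | IsSubwordOf w W ∧ w.length = N} =
      (fun i : ℕ => window W i N) '' Set.Iio N := by
    ext w
    constructor
    · rintro ⟨hw, hl⟩
      obtain ⟨i, hi, hiw⟩ := h.exists_window hw
      exact ⟨i, hi, by rw [hiw, hl]⟩
    · rintro ⟨i, hi, rfl⟩
      exact ⟨isSubwordOf_window _ _ _, by simp⟩
  have h4 : Set.InjOn (fun i : ℕ => window W i N) (Set.Iio N) := by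
    intro i hi j hj hij
    have hd := h.dvd_of_window_eq le_rfl hij
    simp only [Set.mem_Iio] at hi hj
    have := Int.eq_zero_of_abs_lt_dvd hd (by rw [abs_lt]; omega)
    omega
  rw [h2, h3, h4.ncard_image, Set.ncard_Iio_nat] at h1
  exact h1.symm

/-- Every right special factor is a suffix of a bispecial one. -/
theorem exists_suffix_finiteForks (h : IsLeastPeriod W N) {w : List X}
    (hw : w ∈ rightSpecial W) : ∃ b ∈ finiteForks W, w <:+ b := by
  -- Extending to the left must stop, since right special factors are shorter than `N`.
  induction hd : N - w.length using Nat.strong_induction_on generalizing w with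
  | _ d ih =>
    by_cases hl : w ∈ leftSpecial W
    · exact ⟨w, by rw [finiteForks_eq]; exact ⟨hw, hl⟩, List.suffix_rfl⟩
    · obtain ⟨i, j, hi, hj, hij⟩ := mem_rightSpecial_iff.1 hw
      have hlt := h.length_lt_of_mem_rightSpecial hw
      have he : W (j - 1) = W (i - 1) := by
        by_contra hne
        exact hl (mem_leftSpecial_iff.2 ⟨j, i, hj, hi, hne⟩)
      have hR : (W (i - 1) :: w) ∈ rightSpecial W := by
        refine mem_rightSpecial_iff.2 ⟨i - 1, j - 1, ?_, ?_, ?_⟩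
        · rw [List.length_cons, window_pred, ← hi]
        · rw [List.length_cons, window_pred, ← hj, he]
        · convert hij using 2 <;> simp
      obtain ⟨b, hb, hsuf⟩ := ih (N - (W (i - 1) :: w).length)
        (by rw [List.length_cons]; omega) hR rfl
      exact ⟨b, hb, (List.suffix_cons _ _).trans hsuf⟩

theorem rightSpecial_eq (h : IsLeastPeriod W N) :
    rightSpecial W = {w | ∃ b ∈ finiteForks W, w <:+ b} := by
  ext w
  refine ⟨fun hw => h.exists_suffix_finiteForks hw, ?_⟩
  rintro ⟨b, hb, hwb⟩
  rw [finiteForks_eq] at hb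
  exact rightSpecial_of_suffix hwb hb.1

theorem finite_finiteForks (h : IsLeastPeriod W N) : (finiteForks W).Finite := by
  rw [finiteForks_eq]
  exact h.finite_rightSpecial.subset Set.inter_subset_left

end IsLeastPeriod

/-! ### Cutting a periodic word into two loops -/

/-- The two-sided infinite word with period `W i, …, W (i + M - 1)`. -/
def loop (W : ℤ → X) (i : ℤ) (M : ℕ) : ℤ → X := fun m => W (i + m % M)

theorem loop_add (W : ℤ → X) (i : ℤ) (M : ℕ) (m : ℤ) : loop W i M (m + M) = loop W i M m := by
  simp [loop]

/-- The situation in which `k` is the greatest length of a factor occurring at two positions that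
differ modulo the least period `N`, and the factor of length `k` at `i` occurs, modulo `N`, exactly
at the two positions `i` and `i + M`. -/
structure OccursTwice (W : ℤ → X) (N : ℕ) (i : ℤ) (M k : ℕ) : Prop where
  least : IsLeastPeriod W N
  pos : 0 < M
  lt : M < N
  window_eq : window W i k = window W (i + M) k
  le_of_window_eq : ∀ p q l, ¬ (N : ℤ) ∣ q - p → window W p l = window W q l → l ≤ k
  dvd_or : ∀ p, window W i k = window W p k → (N : ℤ) ∣ p - i ∨ (N : ℤ) ∣ p - (i + M)

namespace OccursTwice

variable {W : ℤ → X} {N : ℕ} {i : ℤ} {M k : ℕ}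

/-- Lets every statement about the first loop serve for the second. -/
theorem symm (h : OccursTwice W N i M k) : OccursTwice W N (i + M) (N - M) k := by
  have hlt := h.lt
  refine ⟨h.least, by omega, by have := h.pos; omega, ?_, h.le_of_window_eq, fun p hp => ?_⟩
  · rw [← h.window_eq]
    exact h.least.window_congr ⟨1, by push_cast [hlt.le]; ring⟩ k
  · rcases h.dvd_or p (h.window_eq.trans hp) with h1 | h1
    · right
      have : p - (i + M + (N - M : ℕ)) = (p - i) - N := by push_cast [hlt.le]; ring
      rw [this]
      exact h1.sub dvd_rfl
    · exact Or.inl h1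

/-- Agreement lasts `k` letters beyond one turn because `W` repeats at `i + M` the `k` letters read
at `i`. -/
theorem loop_eq (h : OccursTwice W N i M k) (m : ℕ) (hm : m < M + k) :
    loop W i M m = W (i + m) := by
  induction m using Nat.strong_induction_on with
  | _ m ih =>
    have hpos := h.pos
    by_cases hlt : m < M
    · rw [loop, Int.emod_eq_of_lt (by positivity) (by exact_mod_cast hlt)]
    · have h1 := ih (m - M) (by omega) (by omega)
      have h2 := window_eq_iff.1 h.window_eq (m - M) (by omega)
      have h3 := loop_add W i M ((m - M : ℕ) : ℤ)
      have h4 : ((m - M : ℕ) : ℤ) + M = m := by omega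
      rw [h4] at h3
      rw [h3, h1, h2, add_assoc, add_comm (M : ℤ), h4]

theorem window_loop (h : OccursTwice W N i M k) {p l : ℕ} (hp : p < M) (hl : l ≤ k + 1) :
    window (loop W i M) p l = window W (i + p) l := by
  refine window_eq_iff.2 fun t ht => ?_
  have := h.loop_eq (p + t) (by omega)
  push_cast at this
  rw [this, add_assoc]

theorem eq_zero (h : OccursTwice W N i M k) {p : ℕ} (hp : p < M)
    (hw : window W i k = window W (i + p) k) : p = 0 := by
  have hlt := h.lt
  rcases h.dvd_or _ hw with h1 | h1 <;>
    · have := Int.eq_zero_of_abs_lt_dvd h1 (by rw [abs_lt]; omega)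
      omega

/-- A shorter period `q` would create an occurrence of the repeated factor at `i + q`, strictly
between its two known ones. -/
theorem isLeastPeriod_loop (h : OccursTwice W N i M k) : IsLeastPeriod (loop W i M) M := by
  refine isLeastPeriod_of_forall_not h.pos (loop_add W i M) fun q hq0 hqM hq => ?_
  lift q to ℕ using hq0.le
  have hqM' : q < M := by exact_mod_cast hqM
  have h1 := h.window_loop h.pos (Nat.le_succ k)
  have h2 := h.window_loop hqM' (Nat.le_succ k)
  have h3 : window (loop W i M) (0 : ℕ) k = window (loop W i M) q k := by
    refine window_eq_iff.2 fun t _ => ?_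
    rw [← hq]
    congr 1
    push_cast
    ring
  rw [h1, h2] at h3
  have := h.eq_zero hqM' (by simpa using h3)
  omega

theorem isSubwordOf_of_loop (h : OccursTwice W N i M k) {w : List X} (hl : w.length ≤ k + 1)
    (hw : IsSubwordOf w (loop W i M)) : IsSubwordOf w W := by
  obtain ⟨p, hp, hpw⟩ := h.isLeastPeriod_loop.exists_window hw
  rw [h.window_loop hp hl] at hpw
  rw [hpw]
  exact isSubwordOf_window _ _ _

theorem length_le_of_mem_rightSpecial_loop (h : OccursTwice W N i M k) {w : List X}
    (hw : w ∈ rightSpecial (loop W i M)) : w.length ≤ k := by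
  by_contra! hlt
  -- A suffix of length `k + 1` still reads as a window of `W`, yet is too long to recur there; so
  -- its two occurrences coincide mod `M`.
  have hw' := rightSpecial_of_suffix (List.drop_suffix (w.length - (k + 1)) w) hw
  have hl : (w.drop (w.length - (k + 1))).length = k + 1 := by simp; omega
  generalize w.drop (w.length - (k + 1)) = z at hw' hl
  have hper := h.isLeastPeriod_loop
  obtain ⟨a, b, ha, hb, hab⟩ := mem_rightSpecial_iff.1 hw'
  rw [hl] at ha hb hab
  have hM : (0 : ℤ) < M := by exact_mod_cast h.pos
  have hmod : ∀ a : ℤ, ∃ p : ℕ, p < M ∧ (M : ℤ) ∣ p - a := fun a => by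
    have h0 := Int.emod_nonneg a hM.ne'
    have h1 := Int.emod_lt_of_pos a hM
    refine ⟨(a % M).toNat, by omega, ?_⟩
    rw [Int.toNat_of_nonneg h0]
    exact ⟨-(a / M), by rw [Int.emod_def]; ring⟩
  obtain ⟨p, hp, hpa⟩ := hmod a
  obtain ⟨q, hq, hqb⟩ := hmod b
  rw [hper.window_congr hpa, h.window_loop hp le_rfl] at ha
  rw [hper.window_congr hqb, h.window_loop hq le_rfl] at hb
  have hN : (N : ℤ) ∣ (i + q) - (i + p) := by
    by_contra hN
    have := h.le_of_window_eq _ _ _ hN (ha.symm.trans hb)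
    omega
  have hlt := h.lt
  have := Int.eq_zero_of_abs_lt_dvd hN (by rw [abs_lt]; omega)
  have hpq : p = q := by omega
  subst hpq
  refine hab (period_congr hper.period ?_)
  have := hqb.sub hpa
  ring_nf at this ⊢
  exact this

/-- The word occurs once per turn of the loop, so only one letter can follow it. -/
theorem window_notMem_rightSpecial_loop (h : OccursTwice W N i M k) :
    window W i k ∉ rightSpecial (loop W i M) := by
  intro hw
  have hper := h.isLeastPeriod_loop
  obtain ⟨a, b, ha, hb, hab⟩ := mem_rightSpecial_iff.1 hw
  rw [length_window] at ha hb hab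
  have hM : (0 : ℤ) < M := by exact_mod_cast h.pos
  have key : ∀ a, window W i k = window (loop W i M) a k → (M : ℤ) ∣ a := fun a ha => by
    have h0 := Int.emod_nonneg a hM.ne'
    have h1 := Int.emod_lt_of_pos a hM
    have hd : (M : ℤ) ∣ (a % M).toNat - a := by
      rw [Int.toNat_of_nonneg h0]
      exact ⟨-(a / M), by rw [Int.emod_def]; ring⟩
    rw [hper.window_congr hd, h.window_loop (by omega) (Nat.le_succ k)] at ha
    have := h.eq_zero (by omega) ha
    exact Int.dvd_of_emod_eq_zero (by omega)
  refine hab (period_congr hper.period ?_)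
  rw [add_sub_add_right_eq_sub]
  exact (key a ha).sub (key b hb)

theorem finiteForks_loop_subset (h : OccursTwice W N i M k) :
    finiteForks (loop W i M) ⊆ finiteForks W \ {window W i k} := by
  intro w hw
  rw [finiteForks_eq] at hw ⊢
  have hk := h.length_le_of_mem_rightSpecial_loop hw.1
  refine ⟨⟨?_, ?_⟩, ?_⟩
  · obtain ⟨x, y, hxy, hx, hy⟩ := hw.1
    exact ⟨x, y, hxy, h.isSubwordOf_of_loop (by simpa using hk) hx,
      h.isSubwordOf_of_loop (by simpa using hk) hy⟩
  · obtain ⟨x, y, hxy, hx, hy⟩ := hw.2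
    exact ⟨x, y, hxy, h.isSubwordOf_of_loop (by simpa using hk) hx,
      h.isSubwordOf_of_loop (by simpa using hk) hy⟩
  · rintro rfl
    exact h.window_notMem_rightSpecial_loop hw.1

theorem not_dvd (h : OccursTwice W N i M k) : ¬ (N : ℤ) ∣ (i + M) - i := by
  intro hd
  have hpos := h.pos
  have hlt := h.lt
  have := Int.eq_zero_of_abs_lt_dvd hd (by rw [abs_lt]; omega)
  omega

/-- Equal neighbours on either side would give a longer repeated factor. -/
theorem window_mem_finiteForks (h : OccursTwice W N i M k) :
    window W i k ∈ finiteForks W := by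
  rw [finiteForks_eq]
  refine ⟨mem_rightSpecial_iff.2 ⟨i, i + M, by simp, by simpa using h.window_eq, fun he => ?_⟩,
    mem_leftSpecial_iff.2 ⟨i, i + M, by simp, by simpa using h.window_eq, fun he => ?_⟩⟩
  · rw [length_window] at he
    have := h.le_of_window_eq i (i + M) (k + 1) h.not_dvd
      (by rw [window_succ, window_succ, he, h.window_eq])
    omega
  · have := h.le_of_window_eq (i - 1) (i + M - 1) (k + 1)
      (by rw [sub_sub_sub_cancel_right]; exact h.not_dvd)
      (by rw [window_pred, window_pred, he, h.window_eq])
    omega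

/-- The two loops cannot both have all forks of `W` but one, unless `W` has only one fork. -/
theorem finiteForks_eq_singleton (hX : ∀ x y z : X, x ≠ y → z = x ∨ z = y)
    (h : OccursTwice W N i M k)
    (h1 : finiteForks (loop W i M) = finiteForks W \ {window W i k})
    (h2 : finiteForks (loop W (i + M) (N - M)) = finiteForks W \ {window W i k}) :
    finiteForks W = {window W i k} := by
  by_contra hne
  have hR : rightSpecial (loop W i M) = rightSpecial (loop W (i + M) (N - M)) := by
    rw [h.isLeastPeriod_loop.rightSpecial_eq, h.symm.isLeastPeriod_loop.rightSpecial_eq, h1, h2]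
  have c1 := h.isLeastPeriod_loop.ncard_rightSpecial hX
  have c2 := h.symm.isLeastPeriod_loop.ncard_rightSpecial hX
  have c := h.least.ncard_rightSpecial hX
  rw [← hR] at c2
  have hlt := h.lt
  -- Equal forks give equal right special sets, hence equal periods.
  have hNM : N = M + M := by omega
  -- Otherwise the overlap covers half the cycle and `M` is itself a period of `W`.
  have hkM : k < M := by
    by_contra! hkM
    refine h.not_dvd (h.least.dvd _ fun s => ?_)
    have hN : (0 : ℤ) < N := by exact_mod_cast h.least.pos
    have hshift : ∀ t : ℕ, t < N → W (i + t + M) = W (i + t) := fun t ht => by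
      by_cases htM : t < M
      · have := window_eq_iff.1 h.window_eq t (by omega)
        rw [this]
        congr 1
        ring
      · have := window_eq_iff.1 h.window_eq (t - M) (by omega)
        push_cast [not_lt.1 htM] at this
        have h3 : i + (M : ℤ) + (t - M) = i + t := by ring
        rw [h3] at this
        rw [← this]
        refine period_congr h.least.period ⟨1, ?_⟩
        rw [hNM]
        push_cast
        ring
    have h0 := Int.emod_nonneg (s - i) hN.ne'
    have h1 := Int.emod_lt_of_pos (s - i) hN
    have h4 := hshift ((s - i) % N).toNat (by omega)
    rw [Int.toNat_of_nonneg h0, Int.emod_def] at h4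
    rw [period_congr h.least.period (i := i + (s - i - N * ((s - i) / N)) + M)
      (j := s + (i + M - i)) ⟨(s - i) / N, by ring⟩, h4]
    exact period_congr h.least.period ⟨-((s - i) / N), by ring⟩
  -- The empty word is thus already counted in the loop, so `v` adds at most `k` suffixes, not `k +
  -- 1`; then `N - 1 ≤ (M - 1) + k < 2 * M - 1`.
  have hnil : [] ∈ rightSpecial (loop W i M) := by
    obtain ⟨b, hb, hbv⟩ : ∃ b ∈ finiteForks W, b ≠ window W i k := by
      by_contra! hall
      exact hne (Set.eq_singleton_iff_unique_mem.2 ⟨h.window_mem_finiteForks, hall⟩)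
    rw [h.isLeastPeriod_loop.rightSpecial_eq]
    exact ⟨b, by rw [h1]; exact ⟨hb, hbv⟩, List.nil_suffix⟩
  have hsub : rightSpecial W ⊆ rightSpecial (loop W i M) ∪
      (fun d => (window W i k).drop d) '' Set.Iio k := by
    intro w hw
    obtain ⟨b, hb, hwb⟩ := h.least.exists_suffix_finiteForks hw
    by_cases hbv : b = window W i k
    · subst hbv
      by_cases hw0 : w = []
      · exact Or.inl (hw0 ▸ hnil)
      · refine Or.inr ⟨k - w.length, ?_, ?_⟩
        · have := List.length_pos_iff.2 hw0
          have := hwb.length_le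
          simp only [length_window] at this
          simp only [Set.mem_Iio]
          omega
        · have := List.suffix_iff_eq_drop.1 hwb
          rw [length_window] at this
          exact this.symm
    · left
      rw [h.isLeastPeriod_loop.rightSpecial_eq]
      exact ⟨b, by rw [h1]; exact ⟨hb, hbv⟩, hwb⟩
  have hfin := (Set.finite_Iio k).image fun d => (window W i k).drop d
  have e1 := Set.ncard_le_ncard hsub (h.isLeastPeriod_loop.finite_rightSpecial.union hfin)
  have e2 := Set.ncard_union_le (rightSpecial (loop W i M))
    ((fun d => (window W i k).drop d) '' Set.Iio k)
  have e3 := Set.ncard_image_le (f := fun d => (window W i k).drop d) (Set.finite_Iio k)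
  rw [Set.ncard_Iio_nat] at e3
  omega

end OccursTwice

theorem IsLeastPeriod.exists_occursTwice (hX : ∀ x y z : X, x ≠ y → z = x ∨ z = y) {W : ℤ → X}
    {N : ℕ} (h : IsLeastPeriod W N) (hN : 1 < N) : ∃ i M k, OccursTwice W N i M k := by
  classical
  let P : ℕ → Prop := fun l => ∃ p q : ℤ, ¬ (N : ℤ) ∣ q - p ∧ window W p l = window W q l
  have hP0 : P 0 := by
    refine ⟨0, 1, fun hd => ?_, by simp [window]⟩
    have := Int.eq_zero_of_abs_lt_dvd hd (by rw [abs_lt]; omega)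
    omega
  have hPN : ∀ l, P l → l ≤ N := fun l ⟨p, q, hd, hw⟩ => by
    by_contra! hl
    exact hd (h.dvd_of_window_eq hl.le hw)
  set k := Nat.findGreatest P N with hk
  have hmax : ∀ p q l, ¬ (N : ℤ) ∣ q - p → window W p l = window W q l → l ≤ k :=
    fun p q l hd hw => Nat.le_findGreatest (hPN l ⟨p, q, hd, hw⟩) ⟨p, q, hd, hw⟩
  obtain ⟨i, j, hd, hw⟩ : P k := Nat.findGreatest_spec (Nat.zero_le N) hP0
  have hN' : (0 : ℤ) < N := by exact_mod_cast h.pos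
  have h0 := Int.emod_nonneg (j - i) hN'.ne'
  have h1 := Int.emod_lt_of_pos (j - i) hN'
  have hr : (j - i) % N ≠ 0 := fun h => hd (Int.dvd_of_emod_eq_zero h)
  obtain ⟨M, hM⟩ : ∃ M : ℕ, (M : ℤ) = (j - i) % N := ⟨_, Int.toNat_of_nonneg h0⟩
  have hMj : (N : ℤ) ∣ j - (i + M) := ⟨(j - i) / N, by rw [hM, Int.emod_def]; ring⟩
  refine ⟨i, M, k, h, by omega, by omega, by rw [hw]; exact (h.window_congr hMj k).symm, hmax,
    fun p hp => ?_⟩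
  -- With two letters, a third occurrence would share its left neighbour with one of these, giving a
  -- repeat of length `k + 1`.
  have hne : W (i - 1) ≠ W (j - 1) := fun he => by
    have := hmax (i - 1) (j - 1) (k + 1) (by rwa [sub_sub_sub_cancel_right])
      (by rw [window_pred, window_pred, he, hw])
    omega
  have hext : ∀ a, window W a k = window W p k → W (p - 1) = W (a - 1) → (N : ℤ) ∣ p - a := by
    intro a ha he
    by_contra hd'
    have := hmax (a - 1) (p - 1) (k + 1) (by rwa [sub_sub_sub_cancel_right])
      (by rw [window_pred, window_pred, he, ha])
    omega
  rcases hX _ _ (W (p - 1)) hne with he | he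
  · exact Or.inl (hext i hp he)
  · have := (hext j (hw.symm.trans hp) he).add hMj
    rw [sub_add_sub_cancel] at this
    exact Or.inr this

/-! ### The Fibonacci bound -/

theorem F_le_succ (n : ℕ) : F n ≤ F (n + 1) := by
  cases n with
  | zero => simp [F]
  | succ n => rw [F]; omega

theorem F_mono : Monotone F := monotone_nat_of_le_succ F_le_succ

/-- The least period of a binary word with `n` finite forks is at most `F (n + 1)`. -/
theorem IsLeastPeriod.le_F (hX : ∀ x y z : X, x ≠ y → z = x ∨ z = y) {W : ℤ → X} {N : ℕ}
    (h : IsLeastPeriod W N) : N ≤ F ((finiteForks W).ncard + 1) := by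
  induction N using Nat.strong_induction_on generalizing W with
  | _ N ih =>
    by_cases hN : 1 < N
    · obtain ⟨i, M, k, ho⟩ := h.exists_occursTwice hX hN
      have hpos := ho.pos
      have hlt := ho.lt
      have ih1 := ih M hlt ho.isLeastPeriod_loop
      have ih2 := ih (N - M) (by omega) ho.symm.isLeastPeriod_loop
      have s1 := ho.finiteForks_loop_subset
      have s2 := ho.symm.finiteForks_loop_subset
      rw [← ho.window_eq] at s2
      have hfin := h.finite_finiteForks
      have hcard := Set.ncard_sdiff_singleton_add_one ho.window_mem_finiteForks hfin
      have hfin' := hfin.sdiff (t := {window W i k})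
      have c1 := Set.ncard_le_ncard s1 hfin'
      have c2 := Set.ncard_le_ncard s2 hfin'
      generalize hm : (finiteForks W \ {window W i k}).ncard = m at *
      rw [← hcard]
      by_cases e1 : (finiteForks (loop W i M)).ncard = m
      · by_cases e2 : (finiteForks (loop W (i + M) (N - M))).ncard = m
        · have q1 := Set.eq_of_subset_of_ncard_le s1 (by omega) hfin'
          have q2 := Set.eq_of_subset_of_ncard_le s2 (by omega) hfin'
          have hs := ho.finiteForks_eq_singleton hX q1 q2
          have hm0 : m = 0 := by rw [← hm, hs]; simp
          subst hm0
          rw [e1] at ih1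
          rw [e2] at ih2
          simp only [F] at ih1 ih2 ⊢
          omega
        · have f1 := F_mono (show (finiteForks (loop W (i + M) (N - M))).ncard + 1 ≤ m by omega)
          rw [e1] at ih1
          rw [F]
          omega
      · have f1 := F_mono (show (finiteForks (loop W i M)).ncard + 1 ≤ m by omega)
        have f2 := F_mono (Nat.succ_le_succ c2)
        simp only [Nat.succ_eq_add_one] at f2
        rw [F]
        omega
    · exact (not_lt.1 hN).trans (F_mono (Nat.zero_le _))

/-! ### Non-periodic words and least periods -/

theorem infinitePower_natCast {u : List X} (hu : u ≠ []) {m : ℕ} (hm : m < u.length) :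
    infinitePower u hu m = u[m] := by
  simp only [infinitePower]
  congr 1
  rw [Int.emod_eq_of_lt (by positivity) (by exact_mod_cast hm)]
  simp

theorem infinitePower_add (u : List X) (hu : u ≠ []) (i : ℤ) :
    infinitePower u hu (i + u.length) = infinitePower u hu i := by
  simp [infinitePower]

theorem window_mul_eq_flatten {W : ℤ → X} {d : ℕ} (hd : ∀ i, W (i + d) = W i) (c : ℕ) :
    window W 0 (d * c) = (List.replicate c (window W 0 d)).flatten := by
  induction c with
  | zero => simp [window]
  | succ c ih =>
    rw [Nat.mul_succ, add_comm, window_add, List.replicate_succ, List.flatten_cons, ← ih]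
    congr 1
    exact window_eq_iff.2 fun t _ => by rw [← hd (0 + t)]; congr 1; ring

/-- The least period of `u^∞` is the length of `u` if `u` is not periodic. -/
theorem isLeastPeriod_infinitePower {u : List X} (hu : u ≠ []) (hprim : ¬ IsPeriodicWord u) :
    IsLeastPeriod (infinitePower u hu) u.length := by
  have hpos : 0 < u.length := List.length_pos_iff.2 hu
  refine isLeastPeriod_of_forall_not hpos (infinitePower_add u hu) fun q hq0 hqN hq => ?_
  lift q to ℕ using hq0.le
  have hq0' : 0 < q := by exact_mod_cast hq0
  have hqN' : q < u.length := by exact_mod_cast hqN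
  -- By Bézout the gcd of two periods is a period; it divides the length of `u`, making `u` a proper
  -- power.
  have hg : ∀ i, infinitePower u hu (i + (Nat.gcd q u.length : ℕ)) = infinitePower u hu i := by
    intro i
    rw [Nat.gcd_eq_gcd_ab, ← add_assoc, period_mul (infinitePower_add u hu), period_mul hq]
  obtain ⟨c, hc⟩ := Nat.gcd_dvd_right q u.length
  have hgq : Nat.gcd q u.length ≤ q := Nat.gcd_le_left _ hq0'
  have hc2 : 2 ≤ c := by
    by_contra! hc2
    interval_cases c <;> omega
  refine hprim ⟨hu, window (infinitePower u hu) 0 (Nat.gcd q u.length), c, hc2, ?_⟩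
  rw [← window_mul_eq_flatten hg, ← hc]
  refine List.ext_getElem (by simp) fun m h1 h2 => ?_
  rw [getElem_window, zero_add, infinitePower_natCast hu h1]

theorem eq_or_eq_of_card_eq_two (hX : Nat.card X = 2) (x y z : X) (hxy : x ≠ y) :
    z = x ∨ z = y := by
  obtain ⟨w, -, hw⟩ := (Nat.card_eq_two_iff' x).1 hX
  by_contra! h
  exact h.2 ((hw z h.1).trans (hw y hxy.symm).symm)

end ForbiddenWords

theorem mainTheorem2 {X : Type*} (hX : Nat.card X = 2)
    (u : List X) (hu : u ≠ []) (hprim : ¬ ForbiddenWords.IsPeriodicWord u)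
    (n : ℕ)
    (hn : (ForbiddenWords.finiteForks (ForbiddenWords.infinitePower u hu)).encard = (n : ℕ∞)) :
    u.length ≤ ForbiddenWords.F (n + 1) := by
  have h := (ForbiddenWords.isLeastPeriod_infinitePower hu hprim).le_F
    (ForbiddenWords.eq_or_eq_of_card_eq_two hX)
  rwa [Set.ncard_def, hn, ENat.toNat_natCast] at h
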